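/- **Setting.** A *wall* is a subset of a plane in $\mathbb R^3$ (together with that plane); a *room* is a finite set $\mathcal W$ of walls. A loudspeaker is at a fixed position $L\in\mathbb R^3$. For a wall $W$ let $s_W$ be the mirror point of $L$, i.e. its reflection in the plane of $W$. The wall $W$ *produces a first-order echo* at $m\in\mathbb R^3$ if $L$ and $m$ lie strictly on the same side of the plane of $W$ and the segment from $s_W$ to $m$ meets this plane in a point of $W$; the echo of a sound emitted at time $t_0$ then arrives at time $t_0+\lVert s_W-m\rVert/c$, where $c>0$ is the speed of sound. A drone carries four non-coplanar microphones with reference positions $m_1^{\rm ini},\dots,m_4^{\rm ini}$. The placement $(v,R)\in\mathbb R^3\times \mathrm{SO}(3)$ moves them to $m_i=Rm_i^{\rm ini}+v$. For each placement, microphone $i$ records the arrival times $\mathcal T_i$ of the echoes from some set of walls of the room that produce a first-order echo at $m_i$ (not necessarily all such walls, since an echo may for instance be obstructed). **The detection algorithm.** Let $\mathcal D_i=\{c^2(t-t_0)^2: t\in\mathcal T_i\}$ and let $$f_M(u_1,\dots,u_4)=\det\begin{pmatrix}0&u_1&\cdots&u_4&1\\u_1&D_{1,1}&\cdots&D_{1,4}&1\\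 \vdots&\vdots&&\vdots&\vdots\\u_4&D_{4,1}&\cdots&D_{4,4}&1\\1&1&\cdots&1&0\end{pmatrix},\qquad D_{i,j}=\lVert m_i-m_j\rVert^2 .$$ For every $(d_1,\dots,d_4)\in\mathcal D_1\times\cdots\times\mathcal D_4$ with $f_M(d_1,\dots,d_4)=0$, the algorithm computes $s=\frac12\tilde M\,(\lVert m_i\rVert^2-d_i)_{i=1}^4$, where $\tilde M$ is the upper $3\times4$ part of the transposed inverse of $M=\begin{pmatrix}m_1&m_2&m_3&m_4\\1&1&1&1\end{pmatrix}$, and outputs the plane through $\frac12(s+L)$ with normal vector $s-L$ together with the four points $(1-\tau_i)s+\tau_i m_i$, $\tau_i=\lVert s-L\rVert^2/(2\langle s-L,s-m_i\rangle)$. The output is *really there* if its plane is the plane of some wall of the room and each of the four points lies on a wall of the room contained in this plane; otherwise it is a *ghost wall*. A placement is *good* if the algorithm outputs no ghost wall, and *bad* otherwise. **Theorem.** The bad placements lie in a subvariety of dimension $\le 5$ of the configuration space $\mathbb R^3\times\mathrm{SO}(3)\subseteq\mathbb R^{12}$, i.e. in a subset that is cut out by real polynomials in the twelve coordinates and whose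 coordinate ring has Krull dimension $\le5$. Consequently, if the placement is chosen at random according to a probability distribution on $\mathbb R^3\times\mathrm{SO}(3)$ that is absolutely continuous with respect to the product of Lebesgue measure and Haar measure, then it is good with probability $1$. -/

import Mathlib

open MeasureTheory

noncomputable section

namespace EchoDrone

/-- Euclidean three-space. -/
abbrev E3 : Type := EuclideanSpace ℝ (Fin 3)

/-! ### Walls, mirror points and echoes -/

/-- A wall: the plane containing it, together with the part of that plane that the wall
actually occupies (which may be bounded, and of any shape). -/
structure Wall where
  /-- the plane containing the wall -/
  plane : AffineSubspace ℝ E3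
  /-- the points of the wall -/
  carrier : Set E3
  plane_nonempty : (plane : Set E3).Nonempty
  finrank_direction : Module.finrank ℝ plane.direction = 2
  carrier_subset : carrier ⊆ plane

instance (W : Wall) : Nonempty W.plane := W.plane_nonempty.to_subtype

/-- The mirror point of the loudspeaker position `L` with respect to the wall `W`: the
reflection of `L` in the plane containing `W`. -/
def Wall.mirror (W : Wall) (L : E3) : E3 := EuclideanGeometry.reflection W.plane L

/-- A sound emitted at `L` can reach `m` by one reflection at the wall `W`: the points `L` and
`m` lie strictly on the same side of the plane of `W`, and the point at which the ray is
reflected, that is the intersection of that plane with the segment from the mirror point to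
`m`, belongs to the wall. -/
def Wall.Echoes (W : Wall) (L m : E3) : Prop :=
  W.plane.SSameSide L m ∧ ∃ p ∈ W.carrier, p ∈ segment ℝ (W.mirror L) m

/-- The time at which the echo from the wall `W` of a sound emitted at `L` at time `t₀` arrives
at `m`, where `c` is the speed of sound. -/
def Wall.arrivalTime (W : Wall) (c t₀ : ℝ) (L m : E3) : ℝ := t₀ + dist (W.mirror L) m / c

/-! ### The wall detection algorithm -/

/-- The `4 × 4` matrix whose columns are the microphone positions, extended by a row of ones. -/
def micMatrix (m : Fin 4 → E3) : Matrix (Fin 4) (Fin 4) ℝ :=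
  !![m 0 0, m 1 0, m 2 0, m 3 0;
     m 0 1, m 1 1, m 2 1, m 3 1;
     m 0 2, m 1 2, m 2 2, m 3 2;
     1, 1, 1, 1]

/-- The upper `3 × 4` part of the transposed inverse of `micMatrix m`. -/
def micMatrixTilde (m : Fin 4 → E3) : Matrix (Fin 3) (Fin 4) ℝ :=
  ((micMatrix m)⁻¹.transpose).submatrix Fin.castSucc id

/-- The Cayley–Menger determinant of the numbers `u i`, taken as the squared distances of a
fifth point from the four microphones, and the squared distances of the microphones. -/
def cayleyMenger (m : Fin 4 → E3) (u : Fin 4 → ℝ) : ℝ :=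
  let D : Fin 4 → Fin 4 → ℝ := fun i j => ‖m i - m j‖ ^ 2
  Matrix.det
    !![0,   u 0,   u 1,   u 2,   u 3,   1;
       u 0, D 0 0, D 0 1, D 0 2, D 0 3, 1;
       u 1, D 1 0, D 1 1, D 1 2, D 1 3, 1;
       u 2, D 2 0, D 2 1, D 2 2, D 2 3, 1;
       u 3, D 3 0, D 3 1, D 3 2, D 3 3, 1;
       1,   1,     1,     1,     1,     0]

/-- The point computed from four squared distances `d i` from the microphones. -/
def computedMirror (m : Fin 4 → E3) (d : Fin 4 → ℝ) : E3 :=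
  WithLp.toLp 2 ((1 / 2 : ℝ) • (micMatrixTilde m).mulVec fun i => ‖m i‖ ^ 2 - d i)

/-- The data of a wall, as returned by the algorithm: a normal vector and a point of the plane,
and four points on the wall. -/
structure DetectedWall where
  normal : E3
  base : E3
  points : Fin 4 → E3

/-- The plane through the base point with the given normal vector. -/
def DetectedWall.plane (w : DetectedWall) : AffineSubspace ℝ E3 :=
  AffineSubspace.mk' w.base (Submodule.span ℝ {w.normal})ᗮ

/-- The wall data computed from the mirror point `s`. The four points are the intersections of
the plane with the lines joining `s` and the microphones. -/
def wallData (L : E3) (m : Fin 4 → E3) (s : E3) : DetectedWall where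
  normal := s - L
  base := (1 / 2 : ℝ) • (s + L)
  points := fun i =>
    let τ : ℝ := ‖s - L‖ ^ 2 / (2 * inner ℝ (s - L) (s - m i))
    (1 - τ) • s + τ • m i

/-- The squared distances computed from a set of arrival times. -/
def squaredDistances (c t₀ : ℝ) (T : Set ℝ) : Set ℝ := (fun t => c ^ 2 * (t - t₀) ^ 2) '' T

/-- The output of the wall detection algorithm, where `T i` is the set of the arrival times of
the first-order echoes recorded by the `i`-th microphone: all choices of one squared distance
for each microphone are tried, and those for which the Cayley–Menger determinant vanishes each
yield a wall. -/
def detectWalls (c t₀ : ℝ) (L : E3) (m : Fin 4 → E3) (T : Fin 4 → Set ℝ) :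
    Set DetectedWall :=
  {w | ∃ d : Fin 4 → ℝ, (∀ i, d i ∈ squaredDistances c t₀ (T i)) ∧ cayleyMenger m d = 0 ∧
    w = wallData L m (computedMirror m d)}

/-- A detected wall is really there: its plane contains a wall of the room, and each of the four
computed points lies on a wall of the room contained in that plane. Otherwise it is a ghost
wall. (Several walls of a room may lie in one plane; the algorithm does not tell them apart.) -/
def DetectedWall.IsReal (w : DetectedWall) (room : Finset Wall) : Prop :=
  (∃ W ∈ room, W.plane = w.plane) ∧
    ∀ i, ∃ W ∈ room, W.plane = w.plane ∧ w.points i ∈ W.carrier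

/-! ### The drone -/

/-- The rotation group. -/
abbrev SO3 : Type := Matrix.specialOrthogonalGroup (Fin 3) ℝ

/-- The configuration space of drone positions, consisting of a translation and a rotation. -/
abbrev Placement : Type := E3 × SO3

/-- The position of the microphones on a drone with placement `g`, where `mIni` is their position
in the reference placement. -/
def mics (mIni : Fin 4 → E3) (g : Placement) (i : Fin 4) : E3 :=
  WithLp.toLp 2 ((g.2 : Matrix (Fin 3) (Fin 3) ℝ).mulVec (mIni i)) + g.1

/-- The arrival times recorded by the microphones at the positions `m`, if the `i`-th microphone
receives the echoes from the walls in `heard i`. -/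
def recordedTimes (c t₀ : ℝ) (L : E3) (m : Fin 4 → E3) (heard : Fin 4 → Set Wall)
    (i : Fin 4) : Set ℝ :=
  (fun W : Wall => W.arrivalTime c t₀ L (m i)) '' heard i

/-- The microphones at the positions `m`, receiving the echoes from the walls in `heard i`, are
in a good position: the algorithm detects no ghost wall. -/
def IsGood (room : Finset Wall) (c t₀ : ℝ) (L : E3) (m : Fin 4 → E3)
    (heard : Fin 4 → Set Wall) : Prop :=
  ∀ w ∈ detectWalls c t₀ L m (recordedTimes c t₀ L m heard), w.IsReal room

/-! ### The configuration space as an algebraic variety and as a measure space -/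

/-- The twelve coordinates of a placement: the entries of the translation vector and of the
rotation matrix. They embed the configuration space into `ℝ¹²` as an algebraic set. -/
def coords (g : Placement) : Fin 3 ⊕ Fin 3 × Fin 3 → ℝ :=
  Sum.elim (fun i => g.1 i) fun p => (g.2 : Matrix (Fin 3) (Fin 3) ℝ) p.1 p.2

/-- A subvariety of the configuration space: the set of common zeros of some real polynomials in
the coordinates. -/
def IsSubvariety (V : Set Placement) : Prop :=
  ∃ I : Ideal (MvPolynomial (Fin 3 ⊕ Fin 3 × Fin 3) ℝ),
    V = coords ⁻¹' MvPolynomial.zeroLocus ℝ I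

/-- The dimension of a subvariety: the Krull dimension of its coordinate ring. -/
def varietyDim (V : Set Placement) : WithBot ℕ∞ :=
  ringKrullDim (MvPolynomial (Fin 3 ⊕ Fin 3 × Fin 3) ℝ ⧸
    MvPolynomial.vanishingIdeal ℝ (coords '' V))

instance : IsTopologicalGroup SO3 where
  continuous_mul := by
    refine Continuous.subtype_mk ?_ _
    exact (continuous_subtype_val.comp continuous_fst).mul
      (continuous_subtype_val.comp continuous_snd)
  continuous_inv := by
    refine Continuous.subtype_mk ?_ _
    exact continuous_subtype_val.star

instance : CompactSpace SO3 := by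
  refine isCompact_iff_compactSpace.mp ?_
  have hK : IsCompact (Set.pi Set.univ fun _ : Fin 3 => Set.pi Set.univ fun _ : Fin 3 =>
      Set.Icc (-1 : ℝ) 1) :=
    isCompact_univ_pi fun _ => isCompact_univ_pi fun _ => isCompact_Icc
  refine hK.of_isClosed_subset ?_ ?_
  · have h : ((Matrix.specialOrthogonalGroup (Fin 3) ℝ : Set (Matrix (Fin 3) (Fin 3) ℝ))) =
        {A | A * A.transpose = 1} ∩ {A | A.det = 1} := by
      ext A
      exact Matrix.mem_specialOrthogonalGroup_iff.trans
        (and_congr_left fun _ => Matrix.mem_orthogonalGroup_iff (Fin 3) ℝ)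
    change IsClosed (Matrix.specialOrthogonalGroup (Fin 3) ℝ : Set (Matrix (Fin 3) (Fin 3) ℝ))
    rw [h]
    exact (isClosed_eq (continuous_id.mul continuous_id.matrix_transpose) continuous_const).inter
      (isClosed_eq (Continuous.matrix_det continuous_id) continuous_const)
  · intro (A : Matrix (Fin 3) (Fin 3) ℝ) hA i _ j _
    have hA' : A * A.transpose = 1 :=
      (Matrix.mem_orthogonalGroup_iff (Fin 3) ℝ).mp (Matrix.mem_specialOrthogonalGroup_iff.mp hA).1
    have h1 : ∑ k, A i k * A i k = 1 := by
      exact (congrFun (congrFun hA' i) i).trans (Matrix.one_apply_eq (α := ℝ) i)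
    have h2 : A i j * A i j ≤ 1 := h1 ▸
      Finset.single_le_sum (f := fun k => A i k * A i k) (fun k _ => mul_self_nonneg _)
        (Finset.mem_univ j)
    exact abs_le.mp (abs_le_one_iff_mul_self_le_one.mpr h2)

instance : MeasurableSpace SO3 := borel SO3

instance : BorelSpace SO3 := ⟨rfl⟩

/-- The natural measure on the configuration space: the product of Lebesgue measure and Haar
measure. -/
def placementMeasure : Measure Placement :=
  (volume : Measure E3).prod (Measure.haar : Measure SO3)

end EchoDrone

end

open EchoDrone

/-! A ghost wall can only come from echoes with at least two different mirror points: if the four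
echoes share the mirror point s, the algorithm recovers s and hence a wall that is really there
(`exists_mirror_ne_of_not_isGood`). The room is finite, so it suffices to study one quadruple s₁, …,
s₄ of mirror points, not all equal. The determinant f_M(‖s₁ - m₁‖², …, ‖s₄ - m₄‖²) is a polynomial
in the placement; the heart of the matter is that it does not vanish identically.

If it vanishes, some point σ satisfies ‖mᵢ - σ‖ = ‖mᵢ - sᵢ‖ for all i
(`exists_of_cayleyMenger_eq_zero`). Suppose this happens at every placement (v, R). For fixed R the
point R⁻¹σ is affine in v, with a linear part ζ that does not depend on R, and comparing quadratic
terms in v gives ‖ζ(v)‖² = 2⟨v, Rζ(v)⟩. Summing over the identity and the three coordinate half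
turns, whose sum is zero, yields ζ = 0, and then all sᵢ coincide (`eq_of_forall_placement_exists`).

Cayley's rational parametrization has dense image in the rotation group. It embeds the coordinate
ring of the configuration space into a localization of a polynomial ring in six variables, so this
ring is a domain of dimension at most 6. Hence the product of the finitely many determinants is
nonzero in it, and its zero locus has dimension at most 5. The locus is a null set because zero sets
of nonzero analytic functions are null; Fubini and the invariance of Haar measure carry this over to
the rotation group. -/

noncomputable section

namespace EchoDrone

/-! ### Matrices acting on space -/

/-- The action of a matrix on Euclidean three-space. -/
def act (A : Matrix (Fin 3) (Fin 3) ℝ) (x : E3) : E3 := WithLp.toLp 2 (A.mulVec x)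

theorem act_add (A : Matrix (Fin 3) (Fin 3) ℝ) (x y : E3) : act A (x + y) = act A x + act A y := by
  simp [act, Matrix.mulVec_add]

theorem act_smul (A : Matrix (Fin 3) (Fin 3) ℝ) (r : ℝ) (x : E3) :
    act A (r • x) = r • act A x := by
  simp [act, Matrix.mulVec_smul]

theorem act_neg (A : Matrix (Fin 3) (Fin 3) ℝ) (x : E3) : act A (-x) = -act A x := by
  simp [act, Matrix.mulVec_neg]

theorem act_zero (A : Matrix (Fin 3) (Fin 3) ℝ) : act A 0 = 0 := by
  simp [act]

theorem act_sum {ι : Type*} (s : Finset ι) (A : Matrix (Fin 3) (Fin 3) ℝ) (x : ι → E3) :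
    act A (∑ i ∈ s, x i) = ∑ i ∈ s, act A (x i) := by
  classical
  induction s using Finset.induction_on with
  | empty => simp [act_zero]
  | insert i s hi ih => rw [Finset.sum_insert hi, Finset.sum_insert hi, act_add, ih]

theorem act_act (A B : Matrix (Fin 3) (Fin 3) ℝ) (x : E3) : act A (act B x) = act (A * B) x := by
  simp [act, Matrix.mulVec_mulVec]

theorem act_one (x : E3) : act 1 x = x := by
  simp [act]

theorem inner_act (A : Matrix (Fin 3) (Fin 3) ℝ) (x y : E3) :
    inner ℝ (act A x) y = inner ℝ x (act A.transpose y) := by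
  simp only [act, PiLp.inner_apply, Matrix.mulVec, dotProduct, Fin.sum_univ_three,
    Matrix.transpose_apply, RCLike.inner_apply, conj_trivial]
  ring

theorem SO3.transpose_mul_self (R : SO3) :
    (R : Matrix (Fin 3) (Fin 3) ℝ).transpose * (R : Matrix (Fin 3) (Fin 3) ℝ) = 1 :=
  (Matrix.mem_orthogonalGroup_iff' (Fin 3) ℝ).mp (Matrix.mem_specialOrthogonalGroup_iff.mp R.2).1

theorem SO3.mul_transpose_self (R : SO3) :
    (R : Matrix (Fin 3) (Fin 3) ℝ) * (R : Matrix (Fin 3) (Fin 3) ℝ).transpose = 1 :=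
  (Matrix.mem_orthogonalGroup_iff (Fin 3) ℝ).mp (Matrix.mem_specialOrthogonalGroup_iff.mp R.2).1

theorem SO3.det_eq_one (R : SO3) : (R : Matrix (Fin 3) (Fin 3) ℝ).det = 1 :=
  (Matrix.mem_specialOrthogonalGroup_iff.mp R.2).2

theorem mics_eq (a : Fin 4 → E3) (g : Placement) (i : Fin 4) : mics a g i = act g.2 (a i) + g.1 :=
  rfl

/-- The identity and the half turns about the coordinate axes. -/
def halfTurn (k : Fin 4) : SO3 :=
  ⟨Matrix.diagonal (![![1, 1, 1], ![1, -1, -1], ![-1, 1, -1], ![-1, -1, 1]] k), by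
    rw [Matrix.mem_specialOrthogonalGroup_iff, Matrix.mem_orthogonalGroup_iff]
    fin_cases k <;> refine ⟨?_, ?_⟩ <;>
      simp [Matrix.diagonal_transpose, Fin.prod_univ_three, Matrix.diagonal_mul_diagonal,
        -Matrix.diagonal_one, funext_iff, Fin.forall_fin_succ]⟩

/-- Averaging over these four rotations removes the term depending on R in
`eq_of_forall_placement_exists`. -/
theorem sum_act_halfTurn (x : E3) : ∑ k, act (halfTurn k) x = 0 := by
  ext i
  fin_cases i <;>
    simp [act, halfTurn, Fin.sum_univ_four, Matrix.mulVec_diagonal]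

/-! ### The microphones -/

theorem affineIndependent_of_not_coplanar {a : Fin 4 → E3} (h : ¬ Coplanar ℝ (Set.range a)) :
    AffineIndependent ℝ a := by
  rw [affineIndependent_iff_finrank_vectorSpan_eq ℝ a (n := 3) (by simp)]
  rw [coplanar_iff_finrank_le_two, not_le] at h
  have h3 : Module.finrank ℝ (vectorSpan ℝ (Set.range a)) ≤ Module.finrank ℝ E3 :=
    Submodule.finrank_le _
  rw [finrank_euclideanSpace_fin] at h3
  omega

theorem eq_zero_of_affineIndependent {a : Fin 4 → E3} (h : AffineIndependent ℝ a) {w : Fin 4 → ℝ}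
    (hw : ∑ i, w i = 0) (hwa : ∑ i, w i • a i = 0) : w = 0 :=
  funext fun i => affineIndependent_iff.mp h Finset.univ w hw hwa i (Finset.mem_univ i)

theorem affineIndependent_mics {a : Fin 4 → E3} (h : AffineIndependent ℝ a) (g : Placement) :
    AffineIndependent ℝ (mics a g) := by
  refine affineIndependent_iff.mpr fun s w hw hwm => affineIndependent_iff.mp h s w hw ?_
  simp only [mics_eq, smul_add, Finset.sum_add_distrib, ← Finset.sum_smul, hw, zero_smul,
    add_zero, ← act_smul, ← act_sum] at hwm
  rw [← act_one (∑ i ∈ s, w i • a i), ← SO3.transpose_mul_self g.2, ← act_act, hwm, act_zero]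

/-! ### The Cayley–Menger determinant -/

/-- The middle entries β of a kernel vector are unnormalized barycentric coordinates of σ with
respect to the microphones. -/
theorem exists_of_cayleyMenger_eq_zero {m : Fin 4 → E3} (hm : AffineIndependent ℝ m)
    {u : Fin 4 → ℝ} (hu : cayleyMenger m u = 0) : ∃ σ : E3, ∀ i, u i = ‖m i - σ‖ ^ 2 := by
  obtain ⟨x, hx, hMx⟩ := Matrix.exists_mulVec_eq_zero_iff.mpr hu
  set β : Fin 4 → ℝ := ![x 1, x 2, x 3, x 4] with hβ
  set p : E3 := ∑ j, β j • m j with hp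
  set c : ℝ := ∑ j, β j * ‖m j‖ ^ 2 with hc
  have h0 : ∑ j, β j * u j + x 5 = 0 := by
    have := congrFun hMx 0
    simp [Matrix.mulVec, dotProduct, Fin.sum_univ_succ] at this
    simp [Fin.sum_univ_four, hβ]
    linarith
  have h5 : x 0 = - ∑ j, β j := by
    have := congrFun hMx 5
    simp [Matrix.mulVec, dotProduct, Fin.sum_univ_succ] at this
    simp [Fin.sum_univ_four, hβ]
    linarith
  have h1 : ∀ i, u i * x 0 + ∑ j, β j * ‖m i - m j‖ ^ 2 + x 5 = 0 := by
    intro i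
    have := congrFun hMx i.succ.castSucc
    fin_cases i <;>
    · simp [Matrix.mulVec, dotProduct, Fin.sum_univ_succ] at this
      simp [Fin.sum_univ_four, hβ]
      linarith
  have h2 : ∀ i, ∑ j, β j * ‖m i - m j‖ ^ 2
      = (∑ j, β j) * ‖m i‖ ^ 2 - 2 * inner ℝ (m i) p + c := by
    intro i
    simp only [hp, hc, inner_sum, inner_smul_right, Finset.mul_sum, Finset.sum_mul,
      ← Finset.sum_sub_distrib, ← Finset.sum_add_distrib]
    refine Finset.sum_congr rfl fun j _ => ?_
    rw [norm_sub_sq_real]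
    ring
  have hpi : ∀ y : E3, ∑ i, β i * inner ℝ (m i) y = inner ℝ p y := by
    intro y
    simp [hp, sum_inner, inner_smul_left]
  -- If the weights sum to zero, ⟨mᵢ, p⟩ does not depend on i, so ⟨p, p⟩ = ∑ βᵢ⟨mᵢ, p⟩ = 0; affine
  -- independence then makes the kernel vector zero.
  by_cases hS : ∑ j, β j = 0
  · exfalso
    have h3 : ∀ i, 2 * inner ℝ (m i) p = c + x 5 := by
      intro i
      have := h1 i
      rw [h2, h5, hS] at this
      linarith
    have hpp : inner ℝ p p = 0 := by
      rw [← hpi p]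
      have : ∀ i, β i * inner ℝ (m i) p = β i * ((c + x 5) / 2) := fun i => by
        rw [← h3 i]; ring
      simp [this, ← Finset.sum_mul, hS]
    have hβ0 := eq_zero_of_affineIndependent hm hS (inner_self_eq_zero.mp hpp)
    have hx5 : x 5 = 0 := by simpa [hβ0] using h0
    have hx0 : x 0 = 0 := by simpa [hβ0] using h5
    have e1 := congrFun hβ0 0
    have e2 := congrFun hβ0 1
    have e3 := congrFun hβ0 2
    have e4 := congrFun hβ0 3
    simp only [hβ, Pi.zero_apply, Matrix.cons_val] at e1 e2 e3 e4
    refine hx (funext fun i => ?_)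
    fin_cases i <;> assumption
  · set S := ∑ j, β j with hSdef
    have h3 : ∀ i, u i = ‖m i‖ ^ 2 - 2 * inner ℝ (m i) (S⁻¹ • p) + (c + x 5) / S := by
      intro i
      have := h1 i
      rw [h2, h5] at this
      rw [inner_smul_right]
      field_simp
      linarith
    -- The inner rows determine u up to this constant; the top row fixes it.
    have h4 : (c + x 5) / S = ‖S⁻¹ • p‖ ^ 2 := by
      have h6 : ∑ j, β j * u j = c - 2 * inner ℝ p (S⁻¹ • p) + (c + x 5) / S * S := by
        rw [← hpi, hc, hSdef, Finset.mul_sum, Finset.mul_sum, ← Finset.sum_sub_distrib,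
          ← Finset.sum_add_distrib]
        refine Finset.sum_congr rfl fun i _ => ?_
        rw [h3 i]
        ring
      rw [eq_neg_of_add_eq_zero_left h0, div_mul_cancel₀ _ hS, inner_smul_right, real_inner_self_eq_norm_sq] at h6
      rw [norm_smul, mul_pow, norm_inv, inv_pow, Real.norm_eq_abs, sq_abs]
      field_simp
      field_simp at h6
      linarith
    exact ⟨S⁻¹ • p, fun i => by rw [h3, norm_sub_sq_real, h4]⟩

theorem micMatrix_det_ne_zero {m : Fin 4 → E3} (hm : AffineIndependent ℝ m) :
    (micMatrix m).det ≠ 0 := by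
  intro h
  obtain ⟨w, hw, hMw⟩ := Matrix.exists_mulVec_eq_zero_iff.mpr h
  refine hw (eq_zero_of_affineIndependent hm ?_ ?_)
  · have := congrFun hMw 3
    simp [micMatrix, Matrix.mulVec, dotProduct, Fin.sum_univ_succ] at this
    simp [Fin.sum_univ_four]
    linarith
  · ext i
    have := congrFun hMw i.castSucc
    fin_cases i <;>
    · simp [micMatrix, Matrix.mulVec, dotProduct, Fin.sum_univ_succ] at this
      simp [Fin.sum_univ_four]
      linarith

/-- The numbers ‖mᵢ‖² - ‖s - mᵢ‖² = 2⟨s, mᵢ⟩ - ‖s‖² are linear in (2s, -‖s‖²), with matrix the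
transpose of `micMatrix m`. Inverting it and dropping the last entry leaves 2s. -/
theorem computedMirror_dist {m : Fin 4 → E3} (hm : AffineIndependent ℝ m) (s : E3) :
    computedMirror m (fun i => ‖s - m i‖ ^ 2) = s := by
  have hu : IsUnit (micMatrix m).transpose.det := by
    rw [Matrix.det_transpose]
    exact (micMatrix_det_ne_zero hm).isUnit
  have h : (fun i => ‖m i‖ ^ 2 - ‖s - m i‖ ^ 2) =
      (micMatrix m).transpose.mulVec ![2 * s 0, 2 * s 1, 2 * s 2, -‖s‖ ^ 2] := by
    funext i
    have h2 : ‖m i‖ ^ 2 - ‖s - m i‖ ^ 2 = 2 * inner ℝ s (m i) - ‖s‖ ^ 2 := by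
      rw [norm_sub_sq_real]; ring
    rw [h2]
    fin_cases i <;>
    · simp [micMatrix, Matrix.mulVec, dotProduct, Fin.sum_univ_succ, PiLp.inner_apply]
      ring
  have h3 : (micMatrix m)⁻¹.transpose.mulVec (fun i => ‖m i‖ ^ 2 - ‖s - m i‖ ^ 2) =
      ![2 * s 0, 2 * s 1, 2 * s 2, -‖s‖ ^ 2] := by
    rw [h, Matrix.mulVec_mulVec, Matrix.transpose_nonsing_inv, Matrix.nonsing_inv_mul _ hu,
      Matrix.one_mulVec]
  ext i
  have h4 := congrFun h3 i.castSucc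
  have h5 : computedMirror m (fun i => ‖s - m i‖ ^ 2) i =
      (1 / 2 : ℝ) * ((micMatrix m)⁻¹.transpose.mulVec
        (fun i => ‖m i‖ ^ 2 - ‖s - m i‖ ^ 2)) i.castSucc := rfl
  rw [h5, h4]
  fin_cases i <;> simp

/-! ### The walls computed from correctly matched echoes -/

theorem mirror_sub_mem_orthogonal (W : Wall) (L : E3) :
    W.mirror L - L ∈ W.plane.directionᗮ := by
  have h := EuclideanGeometry.vsub_orthogonalProjection_mem_direction_orthogonal W.plane L
  rw [Wall.mirror, EuclideanGeometry.reflection_apply']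
  simp only [vsub_eq_sub, vadd_eq_add] at h ⊢
  have e : (EuclideanGeometry.orthogonalProjection W.plane L : E3) - L
      + EuclideanGeometry.orthogonalProjection W.plane L - L =
      (-2 : ℝ) • (L - EuclideanGeometry.orthogonalProjection W.plane L) := by
    module
  rw [e]
  exact Submodule.smul_mem _ _ h

theorem midpoint_mirror_mem (W : Wall) (L : E3) : (1 / 2 : ℝ) • (W.mirror L + L) ∈ W.plane := by
  have e : (1 / 2 : ℝ) • (W.mirror L + L) =
      (EuclideanGeometry.orthogonalProjection W.plane L : E3) := by
    rw [Wall.mirror, EuclideanGeometry.reflection_apply']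
    simp only [vsub_eq_sub, vadd_eq_add]
    module
  rw [e]
  exact EuclideanGeometry.orthogonalProjection_mem L

theorem mirror_ne_of_notMem {W : Wall} {L : E3} (h : L ∉ W.plane) : W.mirror L ≠ L := by
  intro e
  have := midpoint_mirror_mem W L
  rw [e, ← two_smul ℝ L, smul_smul] at this
  norm_num at this
  exact h this

theorem plane_eq (W : Wall) {L : E3} (h : L ∉ W.plane) (m : Fin 4 → E3) :
    W.plane = (wallData L m (W.mirror L)).plane := by
  have hne : W.mirror L - L ≠ 0 := sub_ne_zero.mpr (mirror_ne_of_notMem h)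
  have hdir : W.plane.direction = (Submodule.span ℝ {W.mirror L - L})ᗮ := by
    refine Submodule.eq_of_le_of_finrank_eq ?_ ?_
    · rw [Submodule.le_orthogonal_iff_le_orthogonal, Submodule.span_singleton_le_iff_mem]
      exact mirror_sub_mem_orthogonal W L
    · have h1 := Submodule.finrank_add_finrank_orthogonal (Submodule.span ℝ {W.mirror L - L})
      rw [finrank_span_singleton hne, finrank_euclideanSpace_fin] at h1
      rw [W.finrank_direction]
      omega
  rw [DetectedWall.plane, wallData, ← hdir]
  exact (AffineSubspace.mk'_eq (midpoint_mirror_mem W L)).symm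

/-- The reflection point (1 - t)s + t mᵢ and the midpoint of s and L both lie in the plane, so their
difference is orthogonal to s - L. This equation forces t = τᵢ. -/
theorem wallData_point_mem {W : Wall} {L : E3} {m : Fin 4 → E3} {i : Fin 4}
    (h : W.Echoes L (m i)) : (wallData L m (W.mirror L)).points i ∈ W.carrier := by
  obtain ⟨⟨-, hL, -⟩, p, hpW, a, t, -, -, hat, rfl⟩ := h
  obtain rfl : a = 1 - t := by linarith
  set s := W.mirror L with hs
  have hne : s - L ≠ 0 := sub_ne_zero.mpr (mirror_ne_of_notMem hL)
  have hp : (1 - t) • s + t • m i - (1 / 2 : ℝ) • (s + L) ∈ W.plane.direction :=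
    AffineSubspace.vsub_mem_direction (W.carrier_subset hpW) (midpoint_mirror_mem W L)
  have h0 := Submodule.inner_left_of_mem_orthogonal hp (mirror_sub_mem_orthogonal W L)
  have e : (1 - t) • s + t • m i - (1 / 2 : ℝ) • (s + L) =
      (1 / 2 : ℝ) • (s - L) - t • (s - m i) := by module
  rw [e, inner_sub_right, inner_smul_right, inner_smul_right, real_inner_self_eq_norm_sq] at h0
  have hpos : 0 < ‖s - L‖ ^ 2 := by positivity
  have hin : inner ℝ (s - L) (s - m i) ≠ 0 := by
    intro h1
    rw [h1] at h0
    linarith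
  have ht : ‖s - L‖ ^ 2 / (2 * inner ℝ (s - L) (s - m i)) = t := by
    field_simp
    linarith
  simp only [wallData]
  rwa [ht]

theorem isReal_of_mirror_eq {room : Finset Wall} {L : E3} {m : Fin 4 → E3} {W : Fin 4 → Wall}
    (hW : ∀ i, W i ∈ room ∧ (W i).Echoes L (m i)) {s : E3} (hs : ∀ i, (W i).mirror L = s) :
    (wallData L m s).IsReal room := by
  have h : ∀ i, (W i).plane = (wallData L m s).plane := fun i => by
    rw [← hs i]
    exact plane_eq _ (hW i).2.1.2.1 m
  refine ⟨⟨W 0, (hW 0).1, h 0⟩, fun i => ⟨W i, (hW i).1, h i, ?_⟩⟩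
  rw [← hs i]
  exact wallData_point_mem (hW i).2

/-! ### Echoes of different mirror points -/

/-- An affine function is determined by its values at four affinely independent points, and these
can be prescribed. For injectivity, write z = ∑ wᵢaᵢ and k = ∑ wᵢ; weighting the values with w gives
‖z‖² + k². -/
theorem exists_linearEquiv_inner_add {a : Fin 4 → E3} (ha : AffineIndependent ℝ a) :
    ∃ Φ : (E3 × ℝ) ≃ₗ[ℝ] (Fin 4 → ℝ), ∀ z k i, Φ (z, k) i = inner ℝ (a i) z + k := by
  let Ψ : (Fin 4 → ℝ) →ₗ[ℝ] (E3 × ℝ) :=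
    (Fintype.linearCombination ℝ a).prod (Fintype.linearCombination ℝ fun _ => (1 : ℝ))
  have hfin : Module.finrank ℝ (Fin 4 → ℝ) = Module.finrank ℝ (E3 × ℝ) := by simp
  have hΨ : Function.Injective Ψ := by
    rw [injective_iff_map_eq_zero]
    intro w hw
    have h1 := congrArg Prod.fst hw
    have h2 := congrArg Prod.snd hw
    simp [Ψ, Fintype.linearCombination_apply] at h1 h2
    exact eq_zero_of_affineIndependent ha h2 h1
  let Φ : (E3 × ℝ) →ₗ[ℝ] (Fin 4 → ℝ) :=
    LinearMap.pi fun i => ((innerSL ℝ (a i)).toLinearMap.comp (LinearMap.fst ℝ E3 ℝ)) +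
      LinearMap.snd ℝ E3 ℝ
  have hΦ : Function.Injective Φ := by
    rw [injective_iff_map_eq_zero]
    rintro ⟨z, k⟩ hzk
    obtain ⟨w, hw⟩ := (LinearMap.injective_iff_surjective_of_finrank_eq_finrank hfin).mp hΨ (z, k)
    have h1 := congrArg Prod.fst hw
    have h2 := congrArg Prod.snd hw
    simp [Ψ, Fintype.linearCombination_apply] at h1 h2
    have h3 : ∀ i, inner ℝ (a i) z + k = 0 := fun i => congrFun hzk i
    have h4 : inner ℝ z z + k * k = 0 := by
      have : ∑ i, w i * (inner ℝ (a i) z + k) = inner ℝ z z + k * k := by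
        nth_rewrite 2 [← h1]
        nth_rewrite 2 [← h2]
        simp [sum_inner, inner_smul_left, mul_add, Finset.sum_add_distrib, Finset.sum_mul]
      rw [← this]
      simp [h3]
    have h5 : 0 ≤ inner ℝ z z := real_inner_self_nonneg
    have h6 := mul_self_nonneg k
    exact Prod.ext (inner_self_eq_zero (𝕜 := ℝ).mp (by linarith)) (mul_self_eq_zero.mp (by linarith))
  exact ⟨LinearEquiv.ofInjectiveOfFinrankEq Φ hΦ hfin.symm, fun z k i => rfl⟩

theorem eq_of_forall_placement_exists {a : Fin 4 → E3} (ha : AffineIndependent ℝ a)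
    {s : Fin 4 → E3} (h : ∀ g : Placement, ∃ σ, ∀ i, ‖s i - mics a g i‖ ^ 2 = ‖mics a g i - σ‖ ^ 2)
    (i j : Fin 4) : s i = s j := by
  obtain ⟨Φ, hΦ⟩ := exists_linearEquiv_inner_add ha
  let B : E3 → Fin 4 → ℝ := fun v i => inner ℝ v (s i)
  let ζ : E3 → E3 := fun v => (Φ.symm (B v)).1
  let κ : E3 → ℝ := fun v => (Φ.symm (B v)).2
  have hBneg : ∀ v, B (-v) = -B v := fun v => by funext i; simp [B]
  have key : ∀ (R : SO3) v, ‖ζ v‖ ^ 2 = 2 * inner ℝ v (act R (ζ v)) := by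
    intro R
    let ρ : Fin 4 → ℝ := fun i => inner ℝ (act R (a i)) (s i) - ‖s i‖ ^ 2 / 2
    let ζ₀ : E3 := (Φ.symm ρ).1
    let κ₀ : ℝ := (Φ.symm ρ).2
    -- Cancelling ‖mᵢ‖² in the distance equations leaves Φ(y, k) = B v + ρ with y = R⁻¹σ and k = ⟨v,
    -- σ⟩ - ‖σ‖²/2. Thus y and k are affine in v, and the identity expresses how k depends on y and
    -- v.
    have hq : ∀ v, 2 * (inner ℝ v (act R (ζ v + ζ₀)) - (κ v + κ₀)) = ‖ζ v + ζ₀‖ ^ 2 := by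
      intro v
      obtain ⟨σ, hσ⟩ := h (v, R)
      set y := act (R : Matrix (Fin 3) (Fin 3) ℝ).transpose σ with hy
      have hRy : act R y = σ := by
        rw [hy, act_act, SO3.mul_transpose_self, act_one]
      have hnorm : ‖y‖ ^ 2 = ‖σ‖ ^ 2 := by
        rw [← real_inner_self_eq_norm_sq, ← real_inner_self_eq_norm_sq]
        nth_rewrite 2 [hy]
        rw [← inner_act, hRy]
      have h1 : Φ (y, inner ℝ v σ - ‖σ‖ ^ 2 / 2) = B v + ρ := by
        funext i
        have h2 := hσ i
        rw [norm_sub_sq_real, norm_sub_sq_real, mics_eq] at h2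
        simp only [inner_add_left, inner_add_right] at h2
        rw [hΦ, hy, ← inner_act]
        simp only [B, ρ, Pi.add_apply]
        rw [real_inner_comm (act R (a i)) (s i), real_inner_comm v (s i)] at h2
        linarith
      have h3 : (y, inner ℝ v σ - ‖σ‖ ^ 2 / 2) = Φ.symm (B v) + Φ.symm ρ := by
        rw [← map_add, ← h1, LinearEquiv.symm_apply_apply]
      have h4 : y = ζ v + ζ₀ := congrArg Prod.fst h3
      have h5 : inner ℝ v σ - ‖σ‖ ^ 2 / 2 = κ v + κ₀ := congrArg Prod.snd h3
      rw [← h4, ← h5, hRy, hnorm]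
      ring
    intro v
    -- The combination of the values at v, -v and 0 isolates the part of `hq` that is quadratic in
    -- v.
    have h1 := hq v
    have h2 := hq (-v)
    have h3 := hq 0
    have e1 : ζ (-v) = -ζ v := by simp [ζ, hBneg]
    have e2 : κ (-v) = -κ v := by simp [κ, hBneg]
    have e3 : B 0 = 0 := by funext i; simp [B]
    have e4 : ζ 0 = 0 := by simp [ζ, e3]
    have e5 : κ 0 = 0 := by simp [κ, e3]
    rw [e1, e2, act_add, act_neg] at h2
    rw [e4, e5] at h3
    rw [act_add] at h1
    simp only [inner_add_right, inner_neg_left, inner_neg_right, norm_add_sq_real, norm_neg,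
      zero_add, inner_zero_left] at h1 h2 h3
    linarith
  have hζ : ∀ v, ζ v = 0 := by
    intro v
    have h1 : ∑ _k : Fin 4, ‖ζ v‖ ^ 2 = 2 * inner ℝ v (∑ k, act (halfTurn k) (ζ v)) := by
      rw [inner_sum, Finset.mul_sum]
      exact Finset.sum_congr rfl fun k _ => key (halfTurn k) v
    rw [sum_act_halfTurn, inner_zero_right] at h1
    simpa using h1
  have hs : ∀ v i, inner ℝ v (s i) = κ v := by
    intro v i
    have h1 : Φ (ζ v, κ v) = B v := Φ.apply_symm_apply (B v)
    have h2 := congrFun h1 i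
    rw [hΦ, hζ, inner_zero_right, zero_add] at h2
    exact h2.symm
  exact ext_inner_left ℝ fun v => (hs v i).trans (hs v j).symm

theorem exists_cayleyMenger_ne_zero {a : Fin 4 → E3} (ha : AffineIndependent ℝ a)
    {s : Fin 4 → E3} {i j : Fin 4} (hs : s i ≠ s j) :
    ∃ g : Placement, cayleyMenger (mics a g) (fun i => ‖s i - mics a g i‖ ^ 2) ≠ 0 := by
  by_contra! h
  exact hs (eq_of_forall_placement_exists ha
    (fun g => exists_of_cayleyMenger_eq_zero (affineIndependent_mics ha g) (h g)) i j)

/-- The factor c² turns delays back into squared distances to mirror points. A choice of echoes with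
a single mirror point returns a real wall by `computedMirror_dist` and `isReal_of_mirror_eq`. -/
theorem exists_mirror_ne_of_not_isGood {room : Finset Wall} {L : E3} {c t₀ : ℝ} (hc : 0 < c)
    {m : Fin 4 → E3} (hm : AffineIndependent ℝ m) {heard : Fin 4 → Set Wall}
    (hheard : ∀ i, ∀ W ∈ heard i, W ∈ room ∧ W.Echoes L (m i))
    (h : ¬ IsGood room c t₀ L m heard) :
    ∃ W : Fin 4 → room, (∃ i j, (W i).1.mirror L ≠ (W j).1.mirror L) ∧
      cayleyMenger m (fun i => ‖(W i).1.mirror L - m i‖ ^ 2) = 0 := by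
  simp only [IsGood, not_forall] at h
  obtain ⟨w, ⟨d, hd, hd0, rfl⟩, hw⟩ := h
  simp only [squaredDistances, recordedTimes, Set.mem_image, exists_exists_and_eq_and] at hd
  choose W hWh hWd using hd
  have hWd' : d = fun i => ‖(W i).mirror L - m i‖ ^ 2 := by
    funext i
    rw [← hWd i, Wall.arrivalTime, dist_eq_norm]
    field_simp
    ring
  refine ⟨fun i => ⟨W i, (hheard i _ (hWh i)).1⟩, ?_, hWd' ▸ hd0⟩
  by_contra! hall
  have hs : ∀ i, (W i).mirror L = (W 0).mirror L := fun i => hall i 0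
  refine hw ?_
  simp only [hs] at hWd'
  rw [hWd', computedMirror_dist hm]
  exact isReal_of_mirror_eq (fun i => hheard i _ (hWh i)) hs

/-! ### Quaternions and rotations -/

/-- The matrix of the map `x ↦ q * x * conj q` for the quaternion `q`. -/
def quatMatrix {K : Type*} [CommRing K] (q : Fin 4 → K) : Matrix (Fin 3) (Fin 3) K :=
  !![q 0 ^ 2 + q 1 ^ 2 - q 2 ^ 2 - q 3 ^ 2, 2 * (q 1 * q 2 - q 0 * q 3), 2 * (q 1 * q 3 + q 0 * q 2);
     2 * (q 1 * q 2 + q 0 * q 3), q 0 ^ 2 - q 1 ^ 2 + q 2 ^ 2 - q 3 ^ 2, 2 * (q 2 * q 3 - q 0 * q 1);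
     2 * (q 1 * q 3 - q 0 * q 2), 2 * (q 2 * q 3 + q 0 * q 1), q 0 ^ 2 - q 1 ^ 2 - q 2 ^ 2 + q 3 ^ 2]

/-- The squared norm of a quaternion. -/
def quatNorm {K : Type*} [CommRing K] (q : Fin 4 → K) : K := q 0 ^ 2 + q 1 ^ 2 + q 2 ^ 2 + q 3 ^ 2

theorem quatNorm_ne_zero {q : Fin 4 → ℝ} (hq : q ≠ 0) : quatNorm q ≠ 0 := by
  intro h
  rw [quatNorm, ← Fin.sum_univ_four fun i => q i ^ 2,
    Finset.sum_eq_zero_iff_of_nonneg fun i _ => sq_nonneg _] at h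
  exact hq (funext fun i => pow_eq_zero_iff two_ne_zero |>.mp (h i (Finset.mem_univ i)))

theorem map_quatMatrix {K K' : Type*} [CommRing K] [CommRing K'] (f : K →+* K') (q : Fin 4 → K)
    (i j : Fin 3) : f (quatMatrix q i j) = quatMatrix (fun k => f (q k)) i j := by
  fin_cases i <;> fin_cases j <;> simp [quatMatrix] <;> rw [map_ofNat]

theorem map_quatNorm {K K' : Type*} [CommRing K] [CommRing K'] (f : K →+* K') (q : Fin 4 → K) :
    f (quatNorm q) = quatNorm (fun k => f (q k)) := by
  simp [quatNorm]

theorem quatMatrix_mul_transpose {K : Type*} [CommRing K] (q : Fin 4 → K) :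
    quatMatrix q * (quatMatrix q).transpose = quatNorm q ^ 2 • 1 := by
  ext i j
  fin_cases i <;> fin_cases j <;>
  · simp [quatMatrix, quatNorm, Matrix.mul_apply, Fin.sum_univ_three]
    ring

theorem det_quatMatrix {K : Type*} [CommRing K] (q : Fin 4 → K) :
    (quatMatrix q).det = quatNorm q ^ 3 := by
  simp [quatMatrix, quatNorm, Matrix.det_fin_three]
  ring

/-- The rotation given by a nonzero quaternion. -/
def quatRotation (q : Fin 4 → ℝ) (hq : q ≠ 0) : SO3 :=
  ⟨(quatNorm q)⁻¹ • quatMatrix q, by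
    have h := quatNorm_ne_zero hq
    rw [Matrix.mem_specialOrthogonalGroup_iff, Matrix.mem_orthogonalGroup_iff]
    constructor
    · rw [Matrix.transpose_smul, Matrix.smul_mul, Matrix.mul_smul, quatMatrix_mul_transpose,
        smul_smul, smul_smul]
      field_simp
      simp
    · rw [Matrix.det_smul, det_quatMatrix, Fintype.card_fin]
      field_simp⟩

theorem coe_quatRotation (q : Fin 4 → ℝ) (hq : q ≠ 0) :
    (quatRotation q hq : Matrix (Fin 3) (Fin 3) ℝ) = (quatNorm q)⁻¹ • quatMatrix q := rfl

theorem SO3.adjugate_eq (R : SO3) :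
    (R : Matrix (Fin 3) (Fin 3) ℝ).adjugate = (R : Matrix (Fin 3) (Fin 3) ℝ).transpose := by
  have h : (R : Matrix (Fin 3) (Fin 3) ℝ).adjugate * (R : Matrix (Fin 3) (Fin 3) ℝ) = 1 := by
    rw [Matrix.adjugate_mul, R.det_eq_one, one_smul]
  calc (R : Matrix (Fin 3) (Fin 3) ℝ).adjugate
      = (R : Matrix (Fin 3) (Fin 3) ℝ).adjugate * ((R : Matrix (Fin 3) (Fin 3) ℝ) *
          (R : Matrix (Fin 3) (Fin 3) ℝ).transpose) := by rw [R.mul_transpose_self, mul_one]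
    _ = _ := by rw [← mul_assoc, h, one_mul]

theorem exists_quatMatrix_of_trace_ne (R : SO3) (h : (R : Matrix (Fin 3) (Fin 3) ℝ).trace ≠ -1) :
    ∃ q : Fin 4 → ℝ, q ≠ 0 ∧
      quatMatrix q = quatNorm q • (R : Matrix (Fin 3) (Fin 3) ℝ) := by
  have hT := R.transpose_mul_self
  have hT' := R.mul_transpose_self
  have hA := R.adjugate_eq
  set r := (R : Matrix (Fin 3) (Fin 3) ℝ)
  -- For the rotation given by a unit quaternion q, this vector equals 4 q₀ q.
  refine ⟨![1 + r.trace, r 2 1 - r 1 2, r 0 2 - r 2 0, r 1 0 - r 0 1], fun h0 => h ?_, ?_⟩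
  · have := congrFun h0 0
    simp only [Matrix.cons_val_zero, Pi.zero_apply] at this
    linarith
  rw [Matrix.trace_fin_three]
  -- Orthogonality and the cofactor identities are linear relations between quadratic monomials in
  -- the entries; the claims follow from them by linear algebra.
  have t := fun i j => congrFun (congrFun hT i) j
  have t' := fun i j => congrFun (congrFun hT' i) j
  have ad := fun i j => congrFun (congrFun hA i) j
  rw [Matrix.adjugate_fin_three] at ad
  simp only [Matrix.mul_apply, Matrix.transpose_apply, Fin.sum_univ_three] at t t' ad
  have a00 := ad 0 0
  have a01 := ad 0 1
  have a02 := ad 0 2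
  have a10 := ad 1 0
  have a11 := ad 1 1
  have a12 := ad 1 2
  have a20 := ad 2 0
  have a21 := ad 2 1
  have a22 := ad 2 2
  have t00 := t 0 0
  have t01 := t 0 1
  have t02 := t 0 2
  have t11 := t 1 1
  have t12 := t 1 2
  have t22 := t 2 2
  have s00 := t' 0 0
  have s01 := t' 0 1
  have s02 := t' 0 2
  have s11 := t' 1 1
  have s12 := t' 1 2
  have s22 := t' 2 2
  clear t t' ad hT hT' hA h
  simp at a00 a01 a02 a10 a11 a12 a20 a21 a22 t00 t01 t02 t11 t12 t22 s00 s01 s02 s11 s12 s22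
  have hN : quatNorm ![1 + (r 0 0 + r 1 1 + r 2 2), r 2 1 - r 1 2, r 0 2 - r 2 0, r 1 0 - r 0 1]
      = 4 * (1 + (r 0 0 + r 1 1 + r 2 2)) := by
    simp [quatNorm]
    linarith
  rw [hN]
  ext i j
  fin_cases i <;> fin_cases j <;>
  · simp [quatMatrix]
    linarith

/-- The right multiplications of quaternions by `1` and by the three imaginary units. -/
def quatMulUnit (q : Fin 4 → ℝ) (k : Fin 4) : Fin 4 → ℝ :=
  ![![q 0, q 1, q 2, q 3], ![-q 1, q 0, q 3, -q 2], ![-q 2, -q 3, q 0, q 1],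
    ![-q 3, q 2, -q 1, q 0]] k

theorem quatNorm_quatMulUnit (q : Fin 4 → ℝ) (k : Fin 4) :
    quatNorm (quatMulUnit q k) = quatNorm q := by
  fin_cases k <;> · simp [quatNorm, quatMulUnit]; try ring

/-- The imaginary units are the quaternions of the coordinate half turns. This reduces rotations of
trace -1 to the previous case. -/
theorem quatMatrix_quatMulUnit (q : Fin 4 → ℝ) (k : Fin 4) :
    quatMatrix (quatMulUnit q k) = quatMatrix q * (halfTurn k : Matrix (Fin 3) (Fin 3) ℝ) := by
  ext i j
  fin_cases k <;> fin_cases i <;> fin_cases j <;>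
  · simp [quatMatrix, quatMulUnit, halfTurn, Matrix.mul_diagonal]
    try ring

theorem halfTurn_mul_self (k : Fin 4) : halfTurn k * halfTurn k = 1 := by
  apply Subtype.ext
  ext i j
  fin_cases k <;> fin_cases i <;> fin_cases j <;> simp [halfTurn]

/-- The four half-turn matrices sum to zero, so the four traces sum to 0 and not to -4. -/
theorem exists_trace_mul_halfTurn_ne (R : SO3) :
    ∃ k, ((R * halfTurn k : SO3) : Matrix (Fin 3) (Fin 3) ℝ).trace ≠ -1 := by
  by_contra! h
  have h0 := h 0
  have h1 := h 1
  have h2 := h 2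
  have h3 := h 3
  simp [halfTurn, Matrix.trace_fin_three, Matrix.mul_diagonal] at h0 h1 h2 h3
  linarith

theorem exists_eq_quatRotation (R : SO3) : ∃ q, ∃ hq : q ≠ 0, R = quatRotation q hq := by
  obtain ⟨k, hk⟩ := exists_trace_mul_halfTurn_ne R
  obtain ⟨q, hq, hqR⟩ := exists_quatMatrix_of_trace_ne _ hk
  have hn := quatNorm_ne_zero hq
  refine ⟨quatMulUnit q k, fun h0 => hn ?_, Subtype.ext ?_⟩
  · rw [← quatNorm_quatMulUnit q k, h0]
    simp [quatNorm]
  · rw [coe_quatRotation, quatNorm_quatMulUnit, quatMatrix_quatMulUnit, hqR, Matrix.smul_mul,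
      smul_smul, inv_mul_cancel₀ hn, one_smul, ← Submonoid.coe_mul, mul_assoc,
      halfTurn_mul_self, mul_one]

/-- The quaternion with real part `1` and the given imaginary part. -/
def oneQuat {K : Type*} [CommRing K] (x : Fin 3 → K) : Fin 4 → K := Matrix.vecCons 1 x

theorem oneQuat_ne_zero (x : Fin 3 → ℝ) : oneQuat x ≠ 0 := fun h => by
  simpa [oneQuat] using congrFun h 0

/-- The rational parametrization of the rotation group due to Cayley. -/
def cayley (x : E3) : SO3 := quatRotation (oneQuat x) (oneQuat_ne_zero x)

theorem quatRotation_mem_range_cayley {q : Fin 4 → ℝ} (hq : q ≠ 0) (h0 : q 0 ≠ 0) :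
    quatRotation q hq ∈ Set.range cayley := by
  refine ⟨WithLp.toLp 2 ![q 1 / q 0, q 2 / q 0, q 3 / q 0], Subtype.ext ?_⟩
  have hn := quatNorm_ne_zero hq
  have e : oneQuat ![q 1 / q 0, q 2 / q 0, q 3 / q 0] = fun i => (q 0)⁻¹ * q i := by
    funext i
    fin_cases i <;> simp [oneQuat, h0] <;> field_simp
  have e1 : quatNorm (fun i => (q 0)⁻¹ * q i) = (q 0)⁻¹ ^ 2 * quatNorm q := by
    simp [quatNorm]; ring
  have e2 : quatMatrix (fun i => (q 0)⁻¹ * q i) = (q 0)⁻¹ ^ 2 • quatMatrix q := by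
    ext i j
    fin_cases i <;> fin_cases j <;> · simp [quatMatrix]; ring
  rw [cayley, coe_quatRotation, coe_quatRotation, e, e1, e2, smul_smul]
  congr 1
  field_simp

theorem continuous_quatMatrix : Continuous (quatMatrix : (Fin 4 → ℝ) → _) := by
  refine continuous_matrix fun i j => ?_
  fin_cases i <;> fin_cases j <;> · simp [quatMatrix]; fun_prop

theorem continuous_quatNorm : Continuous (quatNorm : (Fin 4 → ℝ) → ℝ) := by
  unfold quatNorm
  fun_prop

/-- Only quaternions with q₀ = 0 are missed, and these are limits of quaternions with q₀ = t ≠ 0. -/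
theorem denseRange_cayley : DenseRange cayley := by
  intro R
  obtain ⟨q, hq, rfl⟩ := exists_eq_quatRotation R
  by_cases h0 : q 0 = 0
  · have hne : ∀ t : ℝ, Function.update q 0 t ≠ 0 := by
      intro t ht
      refine hq (funext fun i => ?_)
      by_cases hi : i = 0
      · rw [hi, h0]; rfl
      · simpa [hi] using congrFun ht i
    have hup : Continuous fun t : ℝ => Function.update q 0 t := continuous_const.update 0 continuous_id
    have hc : Continuous fun t : ℝ => quatRotation (Function.update q 0 t) (hne t) := by
      refine Continuous.subtype_mk ?_ _
      exact ((continuous_quatNorm.comp hup).inv₀ fun t => quatNorm_ne_zero (hne t)).smul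
        (continuous_quatMatrix.comp hup)
    have e : quatRotation q hq = quatRotation (Function.update q 0 0) (hne 0) := by
      congr 1
      rw [← h0, Function.update_eq_self]
    rw [e]
    refine (hc.range_subset_closure_image_dense (dense_compl_singleton (0 : ℝ))).trans
      (closure_mono ?_) ⟨0, rfl⟩
    rintro _ ⟨t, ht, rfl⟩
    exact quatRotation_mem_range_cayley _ (by simpa using ht)
  · exact subset_closure (quatRotation_mem_range_cayley hq h0)

end EchoDrone

/-! ### Krull dimension and transcendence degree -/

/-- By incomparability, contraction of primes along an integral extension is strictly monotone. -/
theorem ringKrullDim_le_of_isIntegral (R S : Type*) [CommRing R] [CommRing S] [Algebra R S]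
    [Algebra.IsIntegral R S] : ringKrullDim S ≤ ringKrullDim R := by
  refine Order.krullDim_le_of_strictMono (PrimeSpectrum.comap (algebraMap R S)) fun I J hIJ => ?_
  obtain ⟨hle, x, hxJ, hxI⟩ := SetLike.lt_iff_le_and_exists.mp
    (show I.asIdeal < J.asIdeal from hIJ)
  exact Ideal.comap_lt_comap_of_integral_mem_sdiff hle ⟨hxJ, hxI⟩
    (Algebra.IsIntegral.isIntegral x)

/-- By Noether normalization, A is integral over a polynomial ring in s variables; these stay
algebraically independent in B, so s ≤ n. -/
theorem ringKrullDim_le_of_trdeg_le {k A B : Type} [Field k] [CommRing A] [CommRing B]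
    [Nontrivial A] [Algebra k A] [Algebra k B] [Algebra.FiniteType k A] {f : A →ₐ[k] B}
    (hf : Function.Injective f) {n : ℕ} (hn : Algebra.trdeg k B ≤ n) : ringKrullDim A ≤ n := by
  obtain ⟨s, g, hg, hint⟩ := exists_integral_inj_algHom_of_fg k A
  have hs : s ≤ n := by
    have h1 : AlgebraicIndependent k fun i : Fin s => f (g (MvPolynomial.X i)) := by
      exact (MvPolynomial.algebraicIndependent_X (Fin s) k).map' (f := f.comp g) (hf.comp hg)
    have h3 := h1.cardinalMk_le_trdeg.trans hn
    simpa using h3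
  let := g.toRingHom.toAlgebra
  have : Algebra.IsIntegral (MvPolynomial (Fin s) k) A := ⟨hint⟩
  refine (ringKrullDim_le_of_isIntegral (MvPolynomial (Fin s) k) A).trans ?_
  rw [MvPolynomial.ringKrullDim_of_isNoetherianRing, ringKrullDim_eq_zero_of_field]
  simpa using hs

/-- The image of P in B is a domain of dimension at most n + 1, and killing the nonzerodivisor p
lowers the dimension by at least one. -/
theorem ringKrullDim_quotient_le_of_trdeg_le {k P B : Type} [Field k] [CommRing P] [CommRing B]
    [IsDomain B] [Algebra k P] [Algebra k B] [Algebra.FiniteType k P] (φ : P →ₐ[k] B) {n : ℕ}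
    (hn : Algebra.trdeg k B ≤ (n + 1 : ℕ)) {J : Ideal P} (hJ : RingHom.ker φ ≤ J) {p : P}
    (hpJ : p ∈ J) (hp : φ p ≠ 0) : ringKrullDim (P ⧸ J) ≤ n := by
  have hprime : (RingHom.ker φ).IsPrime := RingHom.ker_isPrime _
  have h1 : ringKrullDim (P ⧸ RingHom.ker φ) ≤ (n + 1 : ℕ) :=
    ringKrullDim_le_of_trdeg_le (Ideal.kerLiftAlg_injective φ) hn
  have h2 : Ideal.Quotient.mk (RingHom.ker φ) p ∈ nonZeroDivisors (P ⧸ RingHom.ker φ) := by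
    rw [mem_nonZeroDivisors_iff_ne_zero, Ne, Ideal.Quotient.eq_zero_iff_mem]
    exact hp
  have h3 := ringKrullDim_succ_le_of_surjective (Ideal.Quotient.factor hJ)
    (Ideal.Quotient.factor_surjective hJ) h2
    (by rw [Ideal.Quotient.factor_mk, Ideal.Quotient.eq_zero_iff_mem]; exact hpJ)
  have h4 := h3.trans h1
  push_cast at h4
  exact (ENat.WithBot.add_le_add_one_right_iff).mp h4

theorem trdeg_localizationAway {k ι : Type} [Field k] {d : MvPolynomial ι k} (hd : d ≠ 0) :
    Algebra.trdeg k (Localization.Away d) = Cardinal.mk ι := by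
  have hle : Submonoid.powers d ≤ nonZeroDivisors (MvPolynomial ι k) :=
    powers_le_nonZeroDivisors_of_noZeroDivisors hd
  have := IsLocalization.isDomain_localization hle
  have : FaithfulSMul (MvPolynomial ι k) (Localization.Away d) :=
    (faithfulSMul_iff_algebraMap_injective _ _).mpr (IsLocalization.injective _ hle)
  have := IsLocalization.isAlgebraic (Localization.Away d) (Submonoid.powers d)
  rw [← trdeg_add_eq k (MvPolynomial ι k), MvPolynomial.trdeg_of_isDomain,
    trdeg_eq_zero, add_zero, Cardinal.lift_id]

namespace EchoDrone

/-! ### Polynomial functions on the configuration space -/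

theorem continuous_coords : Continuous coords := by
  refine continuous_pi fun k => ?_
  rcases k with i | ⟨i, j⟩
  · exact (PiLp.continuous_apply 2 _ i).comp continuous_fst
  · exact ((continuous_subtype_val.comp continuous_snd)).matrix_elem i j

theorem continuous_aeval_coords (p : MvPolynomial (Fin 3 ⊕ Fin 3 × Fin 3) ℝ) :
    Continuous fun g : Placement => MvPolynomial.aeval (coords g) p := by
  simp only [MvPolynomial.aeval_eq_eval]
  exact (MvPolynomial.continuous_eval p).comp continuous_coords

theorem exists_cayley_mul_ne_zero {p : MvPolynomial (Fin 3 ⊕ Fin 3 × Fin 3) ℝ} {v : E3} {R₀ : SO3}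
    (h : MvPolynomial.aeval (coords (v, R₀)) p ≠ 0) (R : SO3) :
    ∃ x, MvPolynomial.aeval (coords (v, cayley x * R)) p ≠ 0 := by
  by_contra! hx
  refine h ?_
  have hc : IsClosed {S : SO3 | MvPolynomial.aeval (coords (v, S * R)) p = 0} :=
    isClosed_eq ((continuous_aeval_coords p).comp (by fun_prop)) continuous_const
  have h1 := denseRange_cayley.induction_on (p := fun S : SO3 =>
    MvPolynomial.aeval (coords (v, S * R)) p = 0) (R₀ * R⁻¹) hc hx
  simpa using h1

/-- The quaternion with real part `1` and three indeterminates as its imaginary part. -/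
def genericQuat : Fin 4 → MvPolynomial (Fin 3 ⊕ Fin 3) ℝ :=
  oneQuat fun i => MvPolynomial.X (Sum.inr i)

theorem aeval_genericQuat (y : Fin 3 ⊕ Fin 3 → ℝ) (k : Fin 4) :
    MvPolynomial.aeval y (genericQuat k) = oneQuat (fun i => y (Sum.inr i)) k := by
  refine Fin.cases ?_ (fun i => ?_) k <;> simp [genericQuat, oneQuat]

theorem aeval_quatNorm_genericQuat (y : Fin 3 ⊕ Fin 3 → ℝ) :
    MvPolynomial.aeval y (quatNorm genericQuat) = quatNorm (oneQuat fun i => y (Sum.inr i)) := by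
  have := map_quatNorm (MvPolynomial.aeval (R := ℝ) y).toRingHom genericQuat
  simp only [AlgHom.toRingHom_eq_coe, RingHom.coe_coe, aeval_genericQuat] at this
  exact this

theorem quatNorm_genericQuat_ne_zero : quatNorm genericQuat ≠ 0 := by
  intro h
  refine quatNorm_ne_zero (oneQuat_ne_zero fun _ => 0) ?_
  rw [← aeval_quatNorm_genericQuat fun _ => 0, h, map_zero]

/-- The ring of rational functions on which the rational parametrization of the configuration
space is defined. -/
abbrev ParamRing : Type := Localization.Away (quatNorm genericQuat)

theorem isDomain_paramRing : IsDomain ParamRing :=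
  IsLocalization.isDomain_localization
    (powers_le_nonZeroDivisors_of_noZeroDivisors quatNorm_genericQuat_ne_zero)

/-- The pullback of polynomials along the rational parametrization of the configuration space. -/
def paramHom : MvPolynomial (Fin 3 ⊕ Fin 3 × Fin 3) ℝ →ₐ[ℝ] ParamRing :=
  MvPolynomial.aeval (Sum.elim (fun i => algebraMap (MvPolynomial (Fin 3 ⊕ Fin 3) ℝ) ParamRing
      (MvPolynomial.X (Sum.inl i)))
    fun ij => IsLocalization.Away.invSelf (quatNorm genericQuat) *
      algebraMap (MvPolynomial (Fin 3 ⊕ Fin 3) ℝ) ParamRing (quatMatrix genericQuat ij.1 ij.2))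

/-- The evaluation of rational functions at a point. -/
def paramEval (y : Fin 3 ⊕ Fin 3 → ℝ) : ParamRing →+* ℝ :=
  IsLocalization.Away.lift (quatNorm genericQuat) (g := (MvPolynomial.aeval (R := ℝ) y).toRingHom) (by
    have := quatNorm_ne_zero (oneQuat_ne_zero fun i => y (Sum.inr i))
    rw [← aeval_quatNorm_genericQuat] at this
    exact this.isUnit)

theorem paramEval_algebraMap (y : Fin 3 ⊕ Fin 3 → ℝ) (p : MvPolynomial (Fin 3 ⊕ Fin 3) ℝ) :
    paramEval y (algebraMap _ _ p) = MvPolynomial.aeval y p :=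
  IsLocalization.Away.lift_eq _ _ _

theorem paramEval_paramHom (y : Fin 3 ⊕ Fin 3 → ℝ) (p : MvPolynomial (Fin 3 ⊕ Fin 3 × Fin 3) ℝ) :
    paramEval y (paramHom p) = MvPolynomial.aeval (coords (WithLp.toLp 2 fun i => y (Sum.inl i),
      cayley (WithLp.toLp 2 fun i => y (Sum.inr i)))) p := by
  have h : (paramEval y).comp paramHom.toRingHom = (MvPolynomial.aeval (R := ℝ)
      (coords (WithLp.toLp 2 fun i => y (Sum.inl i),
        cayley (WithLp.toLp 2 fun i => y (Sum.inr i))))).toRingHom := by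
    refine MvPolynomial.ringHom_ext (fun r => ?_) fun k => ?_
    · have h1 : paramHom (MvPolynomial.C r) =
          algebraMap (MvPolynomial (Fin 3 ⊕ Fin 3) ℝ) ParamRing (MvPolynomial.C r) := by
        rw [← MvPolynomial.algebraMap_eq, AlgHom.commutes, ← MvPolynomial.algebraMap_eq,
          ← IsScalarTower.algebraMap_apply]
      simp [h1, paramEval_algebraMap]
    · rcases k with i | ⟨i, j⟩
      · simp [paramHom, paramEval_algebraMap, coords]
      · have h2 := congrArg (paramEval y)
          (IsLocalization.Away.mul_invSelf (S := ParamRing) (quatNorm genericQuat))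
        rw [map_mul, map_one, paramEval_algebraMap, aeval_quatNorm_genericQuat] at h2
        have h3 := map_quatMatrix (MvPolynomial.aeval (R := ℝ) y).toRingHom genericQuat i j
        simp only [AlgHom.toRingHom_eq_coe, RingHom.coe_coe, aeval_genericQuat] at h3
        simp [paramHom, paramEval_algebraMap, coords, cayley, coe_quatRotation,
          eq_inv_of_mul_eq_one_right h2, h3]
  exact congrArg (fun f => f p) h

theorem eq_zero_of_forall_paramEval {b : ParamRing} (h : ∀ y, paramEval y b = 0) : b = 0 := by
  obtain ⟨n, a, ha⟩ := IsLocalization.Away.surj (quatNorm genericQuat) b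
  have ha0 : a = 0 := MvPolynomial.funext fun y => by
    rw [map_zero, ← MvPolynomial.aeval_eq_eval, ← paramEval_algebraMap, ← ha, map_mul, h, zero_mul]
  rw [ha0, map_zero] at ha
  exact (IsUnit.mul_left_eq_zero ((IsLocalization.Away.algebraMap_isUnit _).pow n)).mp ha

/-- The kernel of `paramHom` is the vanishing ideal of the configuration space: one direction uses
the density of the Cayley rotations, the other that a rational function vanishing at all real points
is zero. -/
theorem paramHom_eq_zero_iff {p : MvPolynomial (Fin 3 ⊕ Fin 3 × Fin 3) ℝ} :
    paramHom p = 0 ↔ ∀ g, MvPolynomial.aeval (coords g) p = 0 := by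
  refine ⟨fun hp g => ?_, fun h => eq_zero_of_forall_paramEval fun y => ?_⟩
  · by_contra h
    obtain ⟨x, hx⟩ := exists_cayley_mul_ne_zero (v := g.1) (R₀ := g.2) h 1
    refine hx ?_
    have := paramEval_paramHom (Sum.elim g.1 x) p
    rw [hp, map_zero] at this
    rw [mul_one]
    exact this.symm
  · rw [paramEval_paramHom]
    exact h _

theorem isSubvariety_aeval_eq_zero (p : MvPolynomial (Fin 3 ⊕ Fin 3 × Fin 3) ℝ) :
    IsSubvariety {g | MvPolynomial.aeval (coords g) p = 0} := by
  refine ⟨Ideal.span {p}, ?_⟩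
  rw [MvPolynomial.zeroLocus_span]
  ext g
  simp

theorem varietyDim_aeval_eq_zero_le {p : MvPolynomial (Fin 3 ⊕ Fin 3 × Fin 3) ℝ} {g₀ : Placement}
    (hp : MvPolynomial.aeval (coords g₀) p ≠ 0) :
    varietyDim {g | MvPolynomial.aeval (coords g) p = 0} ≤ 5 := by
  have := isDomain_paramRing
  refine ringKrullDim_quotient_le_of_trdeg_le paramHom (n := 5) (p := p) ?_ ?_ ?_ ?_
  · rw [trdeg_localizationAway quatNorm_genericQuat_ne_zero]
    simp
  · rintro q hq _ ⟨g, -, rfl⟩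
    exact paramHom_eq_zero_iff.mp hq g
  · rintro _ ⟨g, hg, rfl⟩
    exact hg
  · exact fun h => hp (paramHom_eq_zero_iff.mp h g₀)

end EchoDrone

/-! ### Zero sets of analytic functions -/

theorem volume_eq_zero_of_analyticOnNhd {f : ℝ → ℝ} (hf : AnalyticOnNhd ℝ f Set.univ) {x₀ : ℝ}
    (h : f x₀ ≠ 0) : volume {x | f x = 0} = 0 := by
  have h1 := ae_restrict_le_codiscreteWithin (μ := (volume : Measure ℝ)) MeasurableSet.univ
    (hf.preimage_zero_mem_codiscrete h)
  rw [Measure.restrict_univ] at h1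
  rw [mem_ae_iff] at h1
  convert h1 using 2
  ext x
  simp

/-- On each line through x₀ the function is analytic and nonzero at x₀, so its zeros are null there.
By Fubini, for some t ≠ 0 the set of y with f(x₀ + ty) = 0 is null; scaling and translating gives
the claim. -/
theorem addHaar_eq_zero_of_analyticOnNhd {E : Type*} [NormedAddCommGroup E] [NormedSpace ℝ E]
    [FiniteDimensional ℝ E] [MeasurableSpace E] [BorelSpace E] (μ : Measure E)
    [μ.IsAddHaarMeasure] {f : E → ℝ} (hf : AnalyticOnNhd ℝ f Set.univ) {x₀ : E} (h : f x₀ ≠ 0) :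
    μ {x | f x = 0} = 0 := by
  have hfc : Continuous f := hf.continuous
  have hT : MeasurableSet {z : ℝ × E | f (x₀ + z.1 • z.2) = 0} :=
    (isClosed_eq (hfc.comp (by fun_prop)) continuous_const).measurableSet
  have h1 : ((volume : Measure ℝ).prod μ) {z : ℝ × E | f (x₀ + z.1 • z.2) = 0} = 0 := by
    rw [Measure.prod_apply_symm hT, lintegral_eq_zero_of_ae_eq_zero]
    refine Filter.Eventually.of_forall fun y => ?_
    refine volume_eq_zero_of_analyticOnNhd (f := fun t : ℝ => f (x₀ + t • y)) (x₀ := 0)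
      (fun t _ => ?_) (by simpa using h)
    exact (hf _ (Set.mem_univ _)).comp (by fun_prop)
  rw [Measure.measure_prod_null hT] at h1
  obtain ⟨t, ht, ht0⟩ := (h1.and (Measure.ae_ne volume (0 : ℝ))).exists
  have h2 : μ ((fun y => t • y) ⁻¹' {y | f (x₀ + y) = 0}) = 0 := ht
  rw [Measure.addHaar_preimage_smul μ ht0, mul_eq_zero] at h2
  rcases h2 with h2 | h2
  · simp [ht0] at h2
  · rw [← measure_preimage_add μ x₀]
    exact h2

namespace EchoDrone

/-! ### The measure of a hypersurface in the configuration space -/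

instance : SecondCountableTopology SO3 :=
  inferInstanceAs (SecondCountableTopology {A : Fin 3 → Fin 3 → ℝ //
    A ∈ (Matrix.specialOrthogonalGroup (Fin 3) ℝ : Set (Matrix (Fin 3) (Fin 3) ℝ))})

theorem analyticAt_cayley (x : E3) (i j : Fin 3) :
    AnalyticAt ℝ (fun x : E3 => (cayley x : Matrix (Fin 3) (Fin 3) ℝ) i j) x := by
  have hq : ∀ k, AnalyticAt ℝ (fun x : E3 => oneQuat x k) x := by
    refine Fin.cases ?_ fun k => ?_
    · exact analyticAt_const
    · exact (EuclideanSpace.proj (𝕜 := ℝ) k).analyticAt x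
  have hn : AnalyticAt ℝ (fun x : E3 => quatNorm (oneQuat x)) x := by
    have h0 := hq 0
    have h1 := hq 1
    have h2 := hq 2
    have h3 := hq 3
    unfold quatNorm
    fun_prop
  have hm : AnalyticAt ℝ (fun x : E3 => quatMatrix (oneQuat x) i j) x := by
    have h0 := hq 0
    have h1 := hq 1
    have h2 := hq 2
    have h3 := hq 3
    fin_cases i <;> fin_cases j <;> · simp [quatMatrix]; fun_prop
  exact (hn.inv (quatNorm_ne_zero (oneQuat_ne_zero x))).mul hm

theorem continuous_cayley : Continuous cayley :=
  Continuous.subtype_mk (continuous_matrix fun i j =>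
    continuous_iff_continuousAt.mpr fun x => (analyticAt_cayley x i j).continuousAt) _

/-- Fubini yields a single x for which the translate of Z by the inverse of `cayley x` is null; left
invariance finishes, with no need to compare Haar measure with Lebesgue measure in the Cayley chart.
-/
theorem haar_eq_zero_of_forall_volume_cayley {Z : Set SO3} (hZ : IsClosed Z)
    (h : ∀ R, volume {x : E3 | cayley x * R ∈ Z} = 0) : (Measure.haar : Measure SO3) Z = 0 := by
  have hT : MeasurableSet {z : E3 × SO3 | cayley z.1 * z.2 ∈ Z} :=
    (hZ.preimage ((continuous_cayley.comp continuous_fst).mul continuous_snd)).measurableSet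
  have h1 : ((volume : Measure E3).prod (Measure.haar : Measure SO3))
      {z : E3 × SO3 | cayley z.1 * z.2 ∈ Z} = 0 := by
    rw [Measure.prod_apply_symm hT, lintegral_eq_zero_of_ae_eq_zero]
    exact Filter.Eventually.of_forall h
  rw [Measure.measure_prod_null hT] at h1
  obtain ⟨x, hx⟩ := h1.exists
  rw [← measure_preimage_mul Measure.haar (cayley x)]
  exact hx

/-- With the rotation of g₀ fixed, p is nonzero for almost every v. For each such v, p is not
identically zero on the rotation group, so its zeros there are Haar null. -/
theorem placementMeasure_aeval_eq_zero {p : MvPolynomial (Fin 3 ⊕ Fin 3 × Fin 3) ℝ}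
    {g₀ : Placement} (hp : MvPolynomial.aeval (coords g₀) p ≠ 0) :
    placementMeasure {g | MvPolynomial.aeval (coords g) p = 0} = 0 := by
  have hZ : IsClosed {g : Placement | MvPolynomial.aeval (coords g) p = 0} :=
    isClosed_eq (continuous_aeval_coords p) continuous_const
  rw [placementMeasure, Measure.measure_prod_null hZ.measurableSet]
  have h1 : volume {v : E3 | MvPolynomial.aeval (coords (v, g₀.2)) p = 0} = 0 := by
    refine addHaar_eq_zero_of_analyticOnNhd volume (x₀ := g₀.1) (fun v _ => ?_) hp
    refine AnalyticAt.aeval_mvPolynomial (fun k => ?_) p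
    rcases k with i | ij
    · exact (EuclideanSpace.proj (𝕜 := ℝ) i).analyticAt v
    · exact analyticAt_const (v := coords g₀ (Sum.inr ij))
  filter_upwards [measure_eq_zero_iff_ae_notMem.mp h1] with v hv
  refine haar_eq_zero_of_forall_volume_cayley (hZ.preimage (by fun_prop)) fun R => ?_
  obtain ⟨x₀, hx₀⟩ := exists_cayley_mul_ne_zero hv R
  refine addHaar_eq_zero_of_analyticOnNhd volume (x₀ := x₀) (fun x _ => ?_) hx₀
  refine AnalyticAt.aeval_mvPolynomial (fun k => ?_) p
  rcases k with i | ⟨i, j⟩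
  · exact analyticAt_const (v := v i)
  · have : (fun x : E3 => coords (v, cayley x * R) (Sum.inr (i, j))) = fun x =>
        ∑ k, (cayley x : Matrix (Fin 3) (Fin 3) ℝ) i k * (R : Matrix (Fin 3) (Fin 3) ℝ) k j := by
      funext x
      simp [coords, Matrix.mul_apply]
    rw [this]
    exact Finset.analyticAt_fun_sum _ fun k _ => (analyticAt_cayley x i k).mul analyticAt_const

/-! ### The Cayley–Menger determinant as a polynomial function -/

/-- The algebra of polynomial functions on the configuration space. -/
def polyFun : Subalgebra ℝ (Placement → ℝ) :=
  (MvPolynomial.aeval (R := ℝ) fun k (g : Placement) => coords g k).range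

theorem mem_polyFun_iff {f : Placement → ℝ} :
    f ∈ polyFun ↔
    ∃ p : MvPolynomial (Fin 3 ⊕ Fin 3 × Fin 3) ℝ, ∀ g, MvPolynomial.aeval (coords g) p = f g := by
  have h : ∀ (p : MvPolynomial (Fin 3 ⊕ Fin 3 × Fin 3) ℝ) (g : Placement),
      MvPolynomial.aeval (R := ℝ) (fun k (g : Placement) => coords g k) p g =
        MvPolynomial.aeval (coords g) p := fun p g =>
    DFunLike.congr_fun (MvPolynomial.comp_aeval (fun k (g : Placement) => coords g k)
      (Pi.evalAlgHom ℝ (fun _ : Placement => ℝ) g)) p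
  simp only [polyFun, AlgHom.mem_range, funext_iff, h]

theorem coords_mem_polyFun (k : Fin 3 ⊕ Fin 3 × Fin 3) : (fun g => coords g k) ∈ polyFun :=
  ⟨MvPolynomial.X k, by simp⟩

theorem const_mem_polyFun (c : ℝ) : (fun _ => c) ∈ polyFun :=
  polyFun.algebraMap_mem c

theorem mics_mem_polyFun (a : Fin 4 → E3) (i : Fin 4) (j : Fin 3) :
    (fun g => mics a g i j) ∈ polyFun := by
  have : (fun g => mics a g i j) = (∑ k, (fun g => coords g (Sum.inr (j, k))) *
      fun _ => a i k) + fun g => coords g (Sum.inl j) := by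
    funext g
    simp [mics, coords, Matrix.mulVec, dotProduct]
  rw [this]
  exact polyFun.add_mem (polyFun.sum_mem fun k _ =>
    polyFun.mul_mem (coords_mem_polyFun _) (const_mem_polyFun _)) (coords_mem_polyFun _)

theorem norm_sub_sq_mem_polyFun {x y : Placement → E3} (hx : ∀ j, (fun g => x g j) ∈ polyFun)
    (hy : ∀ j, (fun g => y g j) ∈ polyFun) : (fun g => ‖x g - y g‖ ^ 2) ∈ polyFun := by
  have : (fun g => ‖x g - y g‖ ^ 2) = ∑ j, ((fun g => x g j) - fun g => y g j) ^ 2 := by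
    funext g
    simp [EuclideanSpace.real_norm_sq_eq]
  rw [this]
  exact polyFun.sum_mem fun j _ => polyFun.pow_mem (polyFun.sub_mem (hx j) (hy j)) 2

theorem det_mem_polyFun {n : Type*} [Fintype n] [DecidableEq n] {A : Placement → Matrix n n ℝ}
    (hA : ∀ i j, (fun g => A g i j) ∈ polyFun) : (fun g => (A g).det) ∈ polyFun := by
  have : (fun g => (A g).det) = ∑ σ : Equiv.Perm n,
      (Equiv.Perm.sign σ : ℤ) • ∏ i, fun g => A g (σ i) i := by
    funext g
    simp [Matrix.det_apply, Units.smul_def]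
  rw [this]
  exact polyFun.sum_mem fun σ _ => polyFun.zsmul_mem (polyFun.prod_mem fun i _ => hA _ _) _

theorem cayleyMenger_mem_polyFun (a s : Fin 4 → E3) :
    (fun g => cayleyMenger (mics a g) fun i => ‖s i - mics a g i‖ ^ 2) ∈ polyFun := by
  have hs : ∀ i, (fun g => ‖s i - mics a g i‖ ^ 2) ∈ polyFun := fun i =>
    norm_sub_sq_mem_polyFun (fun j => const_mem_polyFun _) (mics_mem_polyFun a i)
  have hm : ∀ i j, (fun g => ‖mics a g i - mics a g j‖ ^ 2) ∈ polyFun := fun i j =>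
    norm_sub_sq_mem_polyFun (mics_mem_polyFun a i) (mics_mem_polyFun a j)
  refine det_mem_polyFun fun i j => ?_
  fin_cases i <;> fin_cases j <;> simp [hs, hm, const_mem_polyFun]

/-- There is a polynomial, not vanishing identically on the configuration space, that vanishes at
all placements at which echoes from walls with different mirror points can be matched. -/
theorem exists_polynomial_eq_zero_of_mirror_ne (room : Finset Wall) (L : E3) {a : Fin 4 → E3}
    (ha : AffineIndependent ℝ a) :
    ∃ p : MvPolynomial (Fin 3 ⊕ Fin 3 × Fin 3) ℝ,
      (∃ g, MvPolynomial.aeval (coords g) p ≠ 0) ∧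
      ∀ (g : Placement) (W : Fin 4 → room), (∃ i j, (W i).1.mirror L ≠ (W j).1.mirror L) →
        cayleyMenger (mics a g) (fun i => ‖(W i).1.mirror L - mics a g i‖ ^ 2) = 0 →
        MvPolynomial.aeval (coords g) p = 0 := by
  classical
  choose q hq using fun W : Fin 4 → room =>
    mem_polyFun_iff.mp (cayleyMenger_mem_polyFun a fun i => (W i).1.mirror L)
  let I : Finset (Fin 4 → room) :=
    {W | ∃ i j, (W i).1.mirror L ≠ (W j).1.mirror L}
  refine ⟨∏ W ∈ I, q W, ?_, fun g W hW h0 => ?_⟩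
  · by_contra! h
    have h1 : paramHom (∏ W ∈ I, q W) = 0 := paramHom_eq_zero_iff.mpr h
    have := isDomain_paramRing
    -- Since `ParamRing` is a domain, a vanishing product has a vanishing factor, that is, a
    -- determinant that is zero at all placements.
    rw [map_prod, Finset.prod_eq_zero_iff] at h1
    obtain ⟨W, hW, hqW⟩ := h1
    obtain ⟨i, j, hij⟩ := (Finset.mem_filter.mp hW).2
    obtain ⟨g, hg⟩ := exists_cayleyMenger_ne_zero ha (s := fun i => (W i).1.mirror L) hij
    exact hg ((hq W g).symm.trans (paramHom_eq_zero_iff.mp hqW g))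
  · rw [map_prod]
    exact Finset.prod_eq_zero (Finset.mem_filter.mpr ⟨Finset.mem_univ W, hW⟩) ((hq W g).trans h0)

end EchoDrone

end

/-- `room` is the set of walls of the room, `L` the position of the loudspeaker, `c` the speed of
sound, `t₀` the time of the sound emission, and `mIni` the position of the microphones on the
drone. For a placement `g` of the drone, `heard g i` is the set of walls whose first-order echoes
are received by the `i`-th microphone; it may be any set of walls which produce an echo there
(an echo may fail to be received, for instance because another wall obstructs it). -/
theorem mainTheorem1 (room : Finset Wall) (L : E3) (c t₀ : ℝ) (hc : 0 < c)
    (mIni : Fin 4 → E3) (hmIni : ¬ Coplanar ℝ (Set.range mIni))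
    (heard : Placement → Fin 4 → Set Wall)
    (hheard : ∀ g i, ∀ W ∈ heard g i, W ∈ room ∧ W.Echoes L (mics mIni g i)) :
    (∃ V : Set Placement, IsSubvariety V ∧ varietyDim V ≤ 5 ∧
      ∀ g, ¬ IsGood room c t₀ L (mics mIni g) (heard g) → g ∈ V) ∧
    ∀ P : MeasureTheory.Measure Placement, MeasureTheory.IsProbabilityMeasure P →
      P.AbsolutelyContinuous placementMeasure →
      ∀ᵐ g ∂P, IsGood room c t₀ L (mics mIni g) (heard g) := by
  obtain ⟨p, ⟨g₀, hg₀⟩, hp⟩ := exists_polynomial_eq_zero_of_mirror_ne room L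
    (affineIndependent_of_not_coplanar hmIni)
  have hbad : ∀ g, ¬ IsGood room c t₀ L (mics mIni g) (heard g) →
      MvPolynomial.aeval (coords g) p = 0 := by
    intro g hg
    obtain ⟨W, hW, hW0⟩ := exists_mirror_ne_of_not_isGood hc
      (affineIndependent_mics (affineIndependent_of_not_coplanar hmIni) g) (hheard g) hg
    exact hp g W hW hW0
  refine ⟨⟨_, isSubvariety_aeval_eq_zero p, varietyDim_aeval_eq_zero_le hg₀, hbad⟩,
    fun P _ hP => ?_⟩
  have h0 := hP (placementMeasure_aeval_eq_zero hg₀)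
  filter_upwards [MeasureTheory.measure_eq_zero_iff_ae_notMem.mp h0] with g hg
  by_contra h
  exact hg (hbad g h)
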